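/- Let $\mathcal K=(\mathcal K,\otimes,e,\oplus ,d,(\ )^*,{}^*(\ ))$ be a braided star-autonomous category, that is: a (planar) linearly distributive category in the sense of Cockett and Seely (with $\oplus$ denoting the second tensor product, "par", with unit $d$), with linear distributions $p\otimes(q\oplus r)\to(p\otimes q)\oplus r$ and $(p\oplus q)\otimes r\to p\oplus (q\otimes r)$; for every object $p$ a chosen right dual $p^*$, with unit $\tau_p:e\to p^*\oplus p$ and counit $\gamma_p:p\otimes p^*\to d$, and a chosen left dual ${}^*p$, with unit $e\to p\oplus{}^*p$ and counit ${}^*p\otimes p\to d$, all satisfying the linear triangle identities; and a braiding $\beta_{p,q}:p\otimes q\to q\otimes p$ for $\otimes$. For $f:p\to q$ let $f^*:q^*\to p^*$ be its dual with respect to the chosen right duals. Let $\check\beta_{p,q}:p\oplus q\to q\oplus p$ be the braiding for $\oplus $ induced by duality, that is, the mate of $\beta_{p^*,q^*}:p^*\otimes q^*\to q^*\otimes p^*$, where $q^*\otimes p^*$ is regarded as a right dual of $p\oplus q$ and $p^*\otimes q^*$ as a right dual of $q\oplus p$. A balance for $\mathcal K$ is a natural isomorphism $\theta:\mathrm{Id}_{\mathcal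 K}\to\mathrm{Id}_{\mathcal K}$ such that, for all objects $p,q$, $$\theta_{p\otimes q}=\beta_{q,p}\circ(\theta_q\otimes\theta_p)\circ\beta_{p,q}\qquad\text{and}\qquad \theta_{p\oplus q}=\check\beta_{q,p}\circ(\theta_q\oplus \theta_p)\circ\check\beta_{p,q}.$$ The $4\pi$-twist of an object $p$ is the arrow $\chi_p:p\to p$ given by the composite $$p\cong p\otimes e\xrightarrow{\ \mathrm{id}\otimes\tau_p\ }p\otimes(p^*\oplus p)\longrightarrow(p\otimes p^*)\oplus p\xrightarrow{\ (\gamma_p\,\circ\,\beta_{p,p^*}^{-1}\,\circ\,\beta_{p^*,p}^{-1})\,\oplus \,\mathrm{id}\ }d\oplus p\cong p .$$ Let $\theta$ be a balance for $\mathcal K$. Then $\theta_{p^*}=(\theta_p)^*$ for every object $p$ if and only if $\chi_p=\theta_p\circ\theta_p$ for every object $p$. -/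

import Mathlib

open CategoryTheory MonoidalCategory

universe v u

namespace StarAut

/-- A category with a second monoidal structure `(⅋, d)` ("par"), kept apart from the instance
`MonoidalCategory C`, which is the tensor structure `(⊗, e)`. -/
class ParCategory (C : Type u) [Category.{v} C] where
  /-- the par structure `(⅋, d)`, with its associator and unitors -/
  parMonoidal : MonoidalCategory.{v} C

section ParNotation

variable {C : Type u} [Category.{v} C] [ParCategory C]

/-- `X ⅋ Y` -/
abbrev parObj (X Y : C) : C :=
  (ParCategory.parMonoidal (C := C)).tensorObj X Y

/-- the unit `d` of `⅋` -/
abbrev parUnit (C : Type u) [Category.{v} C] [ParCategory C] : C :=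
  (ParCategory.parMonoidal (C := C)).tensorUnit

infixr:70 " ⅋ " => StarAut.parObj

/-- `X ⅋ f` -/
abbrev parWhiskerLeft (X : C) {Y Z : C} (f : Y ⟶ Z) : X ⅋ Y ⟶ X ⅋ Z :=
  (ParCategory.parMonoidal (C := C)).whiskerLeft X f

/-- `f ⅋ Z` -/
abbrev parWhiskerRight {X Y : C} (f : X ⟶ Y) (Z : C) : X ⅋ Z ⟶ Y ⅋ Z :=
  (ParCategory.parMonoidal (C := C)).whiskerRight f Z

/-- `f ⅋ g` -/
abbrev parHom {X X' Y Y' : C} (f : X ⟶ X') (g : Y ⟶ Y') : X ⅋ Y ⟶ X' ⅋ Y' :=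
  (ParCategory.parMonoidal (C := C)).tensorHom f g

infixr:81 " ◁⅋ " => StarAut.parWhiskerLeft
infixl:81 " ▷⅋ " => StarAut.parWhiskerRight
infixr:70 " ⅋ₘ " => StarAut.parHom

/-- the associator `(X ⅋ Y) ⅋ Z ≅ X ⅋ (Y ⅋ Z)` -/
abbrev parAssoc (X Y Z : C) : (X ⅋ Y) ⅋ Z ≅ X ⅋ (Y ⅋ Z) :=
  (ParCategory.parMonoidal (C := C)).associator X Y Z

/-- the left unitor `d ⅋ X ≅ X` -/
abbrev parLeftUnitor (X : C) : parUnit C ⅋ X ≅ X :=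
  (ParCategory.parMonoidal (C := C)).leftUnitor X

/-- the right unitor `X ⅋ d ≅ X` -/
abbrev parRightUnitor (X : C) : X ⅋ parUnit C ≅ X :=
  (ParCategory.parMonoidal (C := C)).rightUnitor X

end ParNotation

/-- Linearly distributive categories (planar, i.e. without any symmetry): monoidal structures
`(⊗, e)` and `(⅋, d)` with natural linear distributions satisfying the coherence conditions of
Cockett and Seely. -/
class LinearlyDistributiveCategory (C : Type u) [Category.{v} C] [MonoidalCategory C]
    [ParCategory C] where
  /-- the left linear distribution -/
  distL (q s t : C) : q ⊗ (s ⅋ t) ⟶ (q ⊗ s) ⅋ t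
  /-- the right linear distribution -/
  distR (p q s : C) : (p ⅋ q) ⊗ s ⟶ p ⅋ (q ⊗ s)
  distL_naturality {q q' s s' t t' : C} (f : q ⟶ q') (g : s ⟶ s') (h : t ⟶ t') :
    (f ⊗ₘ (g ⅋ₘ h)) ≫ distL q' s' t' = distL q s t ≫ ((f ⊗ₘ g) ⅋ₘ h)
  distR_naturality {p p' q q' s s' : C} (f : p ⟶ p') (g : q ⟶ q') (h : s ⟶ s') :
    ((f ⅋ₘ g) ⊗ₘ h) ≫ distR p' q' s' = distR p q s ≫ (f ⅋ₘ (g ⊗ₘ h))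
  /-- coherence with the units -/
  distL_leftUnitor (s t : C) :
    distL (𝟙_ C) s t ≫ (λ_ s).hom ▷⅋ t = (λ_ (s ⅋ t)).hom
  distL_parRightUnitor (q s : C) :
    distL q s (parUnit C) ≫ (parRightUnitor (q ⊗ s)).hom = q ◁ (parRightUnitor s).hom
  distR_rightUnitor (p q : C) :
    distR p q (𝟙_ C) ≫ p ◁⅋ (ρ_ q).hom = (ρ_ (p ⅋ q)).hom
  distR_parLeftUnitor (q s : C) :
    distR (parUnit C) q s ≫ (parLeftUnitor (q ⊗ s)).hom = (parLeftUnitor q).hom ▷ s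
  /-- coherence of one distribution with the associators -/
  distL_tensor (p q s t : C) :
    distL (p ⊗ q) s t ≫ (α_ p q s).hom ▷⅋ t =
      (α_ p q (s ⅋ t)).hom ≫ p ◁ distL q s t ≫ distL p (q ⊗ s) t
  distR_tensor (p q s t : C) :
    (α_ (p ⅋ q) s t).hom ≫ distR p q (s ⊗ t) =
      distR p q s ▷ t ≫ distR p (q ⊗ s) t ≫ p ◁⅋ (α_ q s t).hom
  distL_par (p q s t : C) :
    p ◁ (parAssoc q s t).hom ≫ distL p q (s ⅋ t) =
      distL p (q ⅋ s) t ≫ distL p q s ▷⅋ t ≫ (parAssoc (p ⊗ q) s t).hom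
  distR_par (p q s t : C) :
    distR (p ⅋ q) s t ≫ (parAssoc p q (s ⊗ t)).hom =
      (parAssoc p q s).hom ▷ t ≫ distR p (q ⅋ s) t ≫ p ◁⅋ distR q s t
  /-- coherence between the two distributions -/
  distL_distR_tensor (p q s t : C) :
    distL p q s ▷ t ≫ distR (p ⊗ q) s t =
      (α_ p (q ⅋ s) t).hom ≫ p ◁ distR q s t ≫ distL p q (s ⊗ t)
  distL_distR_par (p q s t : C) :
    distL (p ⅋ q) s t ≫ distR p q s ▷⅋ t ≫ (parAssoc p (q ⊗ s) t).hom =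
      distR p q (s ⅋ t) ≫ p ◁⅋ distL q s t

open LinearlyDistributiveCategory

/-- Star-autonomous categories (not assumed braided): linearly distributive categories with a chosen
right dual `perp p` (written `p*`) and a chosen left dual `prep p` (written `*p`) of every object
`p`, each given with its unit `τ` and counit `γ` satisfying the linear triangle identities. -/
class StarAutonomousCategory (C : Type u) [Category.{v} C] [MonoidalCategory C]
    [ParCategory C] extends LinearlyDistributiveCategory C where
  /-- the right dual `p*` -/
  perp : C → C
  /-- `τ : e ⟶ p* ⅋ p` -/
  perpUnit (p : C) : 𝟙_ C ⟶ perp p ⅋ p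
  /-- `γ : p ⊗ p* ⟶ d` -/
  perpCounit (p : C) : p ⊗ perp p ⟶ parUnit C
  perp_triangle (p : C) :
    (ρ_ p).inv ≫ p ◁ perpUnit p ≫ distL p (perp p) p ≫ perpCounit p ▷⅋ p ≫
      (parLeftUnitor p).hom = 𝟙 p
  perp_triangle' (p : C) :
    (λ_ (perp p)).inv ≫ perpUnit p ▷ perp p ≫ distR (perp p) p (perp p) ≫
      perp p ◁⅋ perpCounit p ≫ (parRightUnitor (perp p)).hom = 𝟙 (perp p)
  /-- the left dual `*p` -/
  prep : C → C
  /-- `τ : e ⟶ p ⅋ *p` -/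
  prepUnit (p : C) : 𝟙_ C ⟶ p ⅋ prep p
  /-- `γ : *p ⊗ p ⟶ d` -/
  prepCounit (p : C) : prep p ⊗ p ⟶ parUnit C
  prep_triangle (p : C) :
    (λ_ p).inv ≫ prepUnit p ▷ p ≫ distR p (prep p) p ≫ p ◁⅋ prepCounit p ≫
      (parRightUnitor p).hom = 𝟙 p
  prep_triangle' (p : C) :
    (ρ_ (prep p)).inv ≫ prep p ◁ prepUnit p ≫ distL (prep p) p (prep p) ≫
      prepCounit p ▷⅋ prep p ≫ (parLeftUnitor (prep p)).hom = 𝟙 (prep p)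

open StarAutonomousCategory

section

variable {C : Type u} [Category.{v} C] [MonoidalCategory C] [ParCategory C]
  [StarAutonomousCategory C]

/-- The action `f* : q* ⟶ p*` of the right dual on an arrow `f : p ⟶ q`. -/
def perpMap {p q : C} (f : p ⟶ q) : perp q ⟶ perp p :=
  (λ_ (perp q)).inv ≫ perpUnit p ▷ perp q ≫ (perp p ◁⅋ f) ▷ perp q ≫
    distR (perp p) q (perp q) ≫ perp p ◁⅋ perpCounit q ≫ (parRightUnitor (perp p)).hom

/-- The counit exhibiting `q* ⊗ p*` as a right dual of `p ⅋ q`. -/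
def parCounit (p q : C) : (p ⅋ q) ⊗ (perp q ⊗ perp p) ⟶ parUnit C :=
  (α_ (p ⅋ q) (perp q) (perp p)).inv ≫ distR p q (perp q) ▷ perp p ≫
    (p ◁⅋ perpCounit q) ▷ perp p ≫ (parRightUnitor p).hom ▷ perp p ≫ perpCounit p

/-- The unit exhibiting `q* ⊗ p*` as a right dual of `p ⅋ q`. -/
def parUnitMap (p q : C) : 𝟙_ C ⟶ (perp q ⊗ perp p) ⅋ (p ⅋ q) :=
  perpUnit q ≫ (ρ_ (perp q)).inv ▷⅋ q ≫ (perp q ◁ perpUnit p) ▷⅋ q ≫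
    distL (perp q) (perp p) p ▷⅋ q ≫ (parAssoc (perp q ⊗ perp p) p q).hom

variable [BraidedCategory C]

/-- The braiding `p ⅋ q ⟶ q ⅋ p` induced by duality from the braiding of `⊗`: the mate of
`p* ⊗ q* ⟶ q* ⊗ p*` under the dualities between `q ⅋ p` and `p* ⊗ q*` and between `p ⅋ q` and
`q* ⊗ p*`. -/
def parBraiding (p q : C) : p ⅋ q ⟶ q ⅋ p :=
  (ρ_ (p ⅋ q)).inv ≫ (p ⅋ q) ◁ parUnitMap q p ≫
    distL (p ⅋ q) (perp p ⊗ perp q) (q ⅋ p) ≫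
    ((p ⅋ q) ◁ (β_ (perp p) (perp q)).hom ≫ parCounit p q) ▷⅋ (q ⅋ p) ≫
    (parLeftUnitor (q ⅋ p)).hom

/-- The component `θ_p : p ⟶ p`. -/
abbrev component (θ : 𝟭 C ≅ 𝟭 C) (p : C) : p ⟶ p := θ.hom.app p

/-- A natural automorphism of the identity functor is a balance for a braided star-autonomous
category if it is a balance for the braiding of `⊗` and for that of `⅋`. -/
structure IsBalance (θ : 𝟭 C ≅ 𝟭 C) : Prop where
  tensor (p q : C) : component θ (p ⊗ q) =
    (β_ p q).hom ≫ (component θ q ⊗ₘ component θ p) ≫ (β_ q p).hom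
  par (p q : C) : component θ (p ⅋ q) =
    parBraiding p q ≫ (component θ q ⅋ₘ component θ p) ≫ parBraiding q p

/-- The canonical `4π`-twist of `p`: bend `p` by the unit and counit of `p*`, with the inverse double
braiding of `p` and `p*` inserted before the counit. -/
def fourPiTwist (p : C) : p ⟶ p :=
  (ρ_ p).inv ≫ p ◁ perpUnit p ≫ distL p (perp p) p ≫
    ((β_ (perp p) p).inv ≫ (β_ p (perp p)).inv ≫ perpCounit p) ▷⅋ p ≫ (parLeftUnitor p).hom

end

end StarAut

/-! Bending with the unit of `p*` is a bijection from pairings `p ⊗ p* ⟶ d` to endomorphisms of `p`,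
with inverse `f ↦ f ▷ p* ≫ γ` (`bend_perpCounit`, `bend_whiskerRight_comp`,
`bend_whiskerRight_perpCounit`). Under it, `h : p* ⟶ p*` is the dual of `f` iff the pairing `p ◁ h ≫
γ` bends to `f` (`eq_perpMap_iff`).

A balance has `θ_d = 1`, so naturality at `γ` together with the tensor axiom turns `γ` precomposed
with the inverse double braiding into `(θ_p ⊗ θ_{p*}) ≫ γ`. Bending gives `χ_p = θ_p ≫ bend (p ◁
θ_{p*} ≫ γ)`; cancelling `θ_p` in `χ_p = θ_p ≫ θ_p` leaves exactly the criterion for `θ_{p*} =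
(θ_p)*`.

The par axiom enters only through `θ_d = 1`, which needs the induced braiding on `d ⅋ d` to be
trivial. -/

namespace StarAut

open LinearlyDistributiveCategory StarAutonomousCategory

section Par

variable {C : Type u} [Category.{v} C] [ParCategory C]

@[simp]
lemma parHom_id_left (X : C) {Y Z : C} (f : Y ⟶ Z) : 𝟙 X ⅋ₘ f = X ◁⅋ f :=
  @MonoidalCategory.id_tensorHom C _ ParCategory.parMonoidal _ _ _ f

@[simp]
lemma parHom_id_right {X Y : C} (f : X ⟶ Y) (Z : C) : f ⅋ₘ 𝟙 Z = f ▷⅋ Z :=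
  @MonoidalCategory.tensorHom_id C _ ParCategory.parMonoidal _ _ f _

lemma parHom_def {X X' Y Y' : C} (f : X ⟶ X') (g : Y ⟶ Y') : f ⅋ₘ g = f ▷⅋ Y ≫ X' ◁⅋ g :=
  @MonoidalCategory.tensorHom_def C _ ParCategory.parMonoidal _ _ _ _ f g

@[simp]
lemma parWhiskerLeft_id (X Y : C) : X ◁⅋ 𝟙 Y = 𝟙 (X ⅋ Y) :=
  @MonoidalCategory.whiskerLeft_id C _ ParCategory.parMonoidal X Y

@[simp]
lemma id_parWhiskerRight (X Y : C) : 𝟙 X ▷⅋ Y = 𝟙 (X ⅋ Y) :=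
  @MonoidalCategory.id_whiskerRight C _ ParCategory.parMonoidal X Y

lemma parWhiskerLeft_comp (X : C) {Y Z W : C} (f : Y ⟶ Z) (g : Z ⟶ W) :
    X ◁⅋ (f ≫ g) = X ◁⅋ f ≫ X ◁⅋ g :=
  @MonoidalCategory.whiskerLeft_comp C _ ParCategory.parMonoidal X _ _ _ f g

lemma comp_parWhiskerRight {X Y Z : C} (f : X ⟶ Y) (g : Y ⟶ Z) (W : C) :
    (f ≫ g) ▷⅋ W = f ▷⅋ W ≫ g ▷⅋ W :=
  @MonoidalCategory.comp_whiskerRight C _ ParCategory.parMonoidal _ _ _ f g W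

lemma par_whisker_exchange {W X Y Z : C} (f : W ⟶ X) (g : Y ⟶ Z) :
    W ◁⅋ g ≫ f ▷⅋ Z = f ▷⅋ Y ≫ X ◁⅋ g :=
  @MonoidalCategory.whisker_exchange C _ ParCategory.parMonoidal _ _ _ _ f g

lemma parLeftUnitor_naturality {X Y : C} (f : X ⟶ Y) :
    parUnit C ◁⅋ f ≫ (parLeftUnitor Y).hom = (parLeftUnitor X).hom ≫ f :=
  @MonoidalCategory.leftUnitor_naturality C _ ParCategory.parMonoidal _ _ f

lemma parRightUnitor_naturality {X Y : C} (f : X ⟶ Y) :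
    f ▷⅋ parUnit C ≫ (parRightUnitor Y).hom = (parRightUnitor X).hom ≫ f :=
  @MonoidalCategory.rightUnitor_naturality C _ ParCategory.parMonoidal _ _ f

lemma parUnitors_equal :
    (parLeftUnitor (parUnit C)).hom = (parRightUnitor (parUnit C)).hom :=
  @MonoidalCategory.unitors_equal C _ ParCategory.parMonoidal

lemma parTriangle (X Y : C) :
    (parAssoc X (parUnit C) Y).hom ≫ X ◁⅋ (parLeftUnitor Y).hom =
      (parRightUnitor X).hom ▷⅋ Y :=
  @MonoidalCategory.triangle C _ ParCategory.parMonoidal X Y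

end Par

section Dist

variable {C : Type u} [Category.{v} C] [MonoidalCategory C] [ParCategory C]
  [LinearlyDistributiveCategory C]

lemma distL_naturality_left {q q' : C} (f : q ⟶ q') (s t : C) :
    f ▷ (s ⅋ t) ≫ distL q' s t = distL q s t ≫ (f ▷ s) ▷⅋ t := by
  simpa using distL_naturality f (𝟙 s) (𝟙 t)

lemma distL_naturality_middle (q : C) {s s' : C} (g : s ⟶ s') (t : C) :
    q ◁ (g ▷⅋ t) ≫ distL q s' t = distL q s t ≫ (q ◁ g) ▷⅋ t := by
  simpa using distL_naturality (𝟙 q) g (𝟙 t)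

lemma distL_naturality_right (q s : C) {t t' : C} (h : t ⟶ t') :
    q ◁ (s ◁⅋ h) ≫ distL q s t' = distL q s t ≫ (q ⊗ s) ◁⅋ h := by
  simpa using distL_naturality (𝟙 q) (𝟙 s) h

lemma distR_naturality_left {p p' : C} (f : p ⟶ p') (q s : C) :
    (f ▷⅋ q) ▷ s ≫ distR p' q s = distR p q s ≫ f ▷⅋ (q ⊗ s) := by
  simpa using distR_naturality f (𝟙 q) (𝟙 s)

lemma distR_naturality_middle (p : C) {q q' : C} (g : q ⟶ q') (s : C) :
    (p ◁⅋ g) ▷ s ≫ distR p q' s = distR p q s ≫ p ◁⅋ (g ▷ s) := by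
  simpa using distR_naturality (𝟙 p) g (𝟙 s)

lemma distR_naturality_right (p q : C) {s s' : C} (h : s ⟶ s') :
    (p ⅋ q) ◁ h ≫ distR p q s' = distR p q s ≫ p ◁⅋ (q ◁ h) := by
  simpa using distR_naturality (𝟙 p) (𝟙 q) h

end Dist

/-! ### Bending, duals of arrows, and the dual of the par unit -/

section Duality

variable {C : Type u} [Category.{v} C] [MonoidalCategory C] [ParCategory C]
  [StarAutonomousCategory C]

/-- The endomorphism of `p` obtained from `g : p ⊗ p* ⟶ d` by bending with the unit of `p*`. -/
def bend {p : C} (g : p ⊗ perp p ⟶ parUnit C) : p ⟶ p :=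
  (ρ_ p).inv ≫ p ◁ perpUnit p ≫ distL p (perp p) p ≫ g ▷⅋ p ≫ (parLeftUnitor p).hom

@[simp]
lemma bend_perpCounit (p : C) : bend (perpCounit p) = 𝟙 p := perp_triangle p

lemma bend_whiskerRight_comp {p : C} (f : p ⟶ p) (g : p ⊗ perp p ⟶ parUnit C) :
    bend (f ▷ perp p ≫ g) = f ≫ bend g := by
  simp only [bend, comp_parWhiskerRight, Category.assoc]
  rw [← reassoc_of% @distL_naturality_left, MonoidalCategory.whisker_exchange_assoc,
    ← MonoidalCategory.rightUnitor_inv_naturality_assoc]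

/-- Sliding the dual of `f` across a pairing `g` bends the pairing. -/
lemma whiskerLeft_perpMap_comp {p q : C} (f : p ⟶ q) (g : p ⊗ perp p ⟶ parUnit C) :
    p ◁ perpMap f ≫ g = (bend g ≫ f) ▷ perp q ≫ perpCounit q := by
  -- The mixed coherence of the two distributions lets the unit of `p*` pair with the copy of `p` on
  -- its left before the remaining `p` meets `q*`.
  have key : p ◁ (perpUnit p ▷ perp q) ≫ p ◁ distR (perp p) p (perp q) ≫
      distL p (perp p) (p ⊗ perp q) =
      (α_ p (𝟙_ C) (perp q)).inv ≫ (p ◁ perpUnit p) ▷ perp q ≫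
        distL p (perp p) p ▷ perp q ≫ distR (p ⊗ perp p) p (perp q) := by
    rw [distL_distR_tensor]
    simp
  have hγ : (parLeftUnitor p).hom ▷ perp q ≫ f ▷ perp q ≫ perpCounit q =
      distR (parUnit C) p (perp q) ≫ parUnit C ◁⅋ (f ▷ perp q ≫ perpCounit q) ≫
        (parLeftUnitor (parUnit C)).hom := by
    rw [parLeftUnitor_naturality, reassoc_of% @distR_parLeftUnitor]
  rw [perpMap, reassoc_of% @distR_naturality_middle]
  simp only [bend, MonoidalCategory.comp_whiskerRight, Category.assoc,
    MonoidalCategory.whiskerLeft_comp]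
  rw [hγ, reassoc_of% @distR_naturality_left, ← reassoc_of% @par_whisker_exchange, parUnitors_equal,
    parRightUnitor_naturality, ← reassoc_of% @distL_parRightUnitor]
  simp only [parWhiskerLeft_comp, Category.assoc]
  rw [reassoc_of% @distL_naturality_right, reassoc_of% @distL_naturality_right, reassoc_of% key]
  simp

/-- The dual of `f` is characterised by compatibility with the counits. -/
lemma eq_perpMap {p q : C} (f : p ⟶ q) (h : perp q ⟶ perp p)
    (w : p ◁ h ≫ perpCounit p = f ▷ perp q ≫ perpCounit q) : h = perpMap f := by
  rw [perpMap, reassoc_of% @distR_naturality_middle, ← reassoc_of% @parWhiskerLeft_comp, ← w,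
    reassoc_of% @parWhiskerLeft_comp, ← reassoc_of% @distR_naturality_right,
    ← MonoidalCategory.whisker_exchange_assoc,
    ← MonoidalCategory.leftUnitor_inv_naturality_assoc, perp_triangle', Category.comp_id]

lemma whiskerLeft_perpMap_perpCounit {p q : C} (f : p ⟶ q) :
    p ◁ perpMap f ≫ perpCounit p = f ▷ perp q ≫ perpCounit q := by
  simp [whiskerLeft_perpMap_comp]

@[simp]
lemma perpMap_id (p : C) : perpMap (𝟙 p) = 𝟙 (perp p) :=
  (eq_perpMap _ _ (by simp)).symm

lemma bend_whiskerRight_perpCounit {p : C} (g : p ⊗ perp p ⟶ parUnit C) :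
    bend g ▷ perp p ≫ perpCounit p = g := by
  simpa using (whiskerLeft_perpMap_comp (𝟙 p) g).symm

/-- The endomorphism mated to `h : p* ⟶ p*` is `f` exactly when `h` is the dual of `f`. -/
lemma eq_perpMap_iff {p : C} (f : p ⟶ p) (h : perp p ⟶ perp p) :
    h = perpMap f ↔ bend (p ◁ h ≫ perpCounit p) = f := by
  constructor
  · rintro rfl
    rw [whiskerLeft_perpMap_perpCounit, bend_whiskerRight_comp]
    simp
  · rintro rfl
    exact eq_perpMap _ _ (bend_whiskerRight_perpCounit _).symm

/-- The comparison `e ⟶ d*`. -/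
def unitToPerp (C : Type u) [Category.{v} C] [MonoidalCategory C] [ParCategory C]
    [StarAutonomousCategory C] : 𝟙_ C ⟶ perp (parUnit C) :=
  perpUnit (parUnit C) ≫ (parRightUnitor _).hom

/-- The comparison `d* ⟶ e`. -/
def perpToUnit (C : Type u) [Category.{v} C] [MonoidalCategory C] [ParCategory C]
    [StarAutonomousCategory C] : perp (parUnit C) ⟶ 𝟙_ C :=
  (λ_ _).inv ≫ (parRightUnitor (𝟙_ C)).inv ▷ _ ≫ distR (𝟙_ C) (parUnit C) _ ≫
    𝟙_ C ◁⅋ perpCounit (parUnit C) ≫ (parRightUnitor (𝟙_ C)).hom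

/-- Sliding `e ⟶ d*` back through the composite recreates the unit of `d*`, leaving a triangle
identity for `d`. This exhibits `d*` as a retract of `e`. -/
lemma perpToUnit_unitToPerp : perpToUnit C ≫ unitToPerp C = 𝟙 _ := by
  have h : (parRightUnitor (𝟙_ C)).inv ≫ unitToPerp C ▷⅋ parUnit C = perpUnit (parUnit C) := by
    rw [Iso.inv_comp_eq, ← cancel_mono (parRightUnitor _).hom, parRightUnitor_naturality,
      Category.assoc, unitToPerp]
  rw [← perp_triangle' (parUnit C), perpToUnit]
  simp only [Category.assoc]
  rw [← parRightUnitor_naturality, reassoc_of% @par_whisker_exchange,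
    ← reassoc_of% @distR_naturality_left,
    ← MonoidalCategory.comp_whiskerRight_assoc, h]

lemma whiskerLeft_unitToPerp_perpCounit :
    parUnit C ◁ unitToPerp C ≫ perpCounit (parUnit C) = (ρ_ (parUnit C)).hom := by
  have h := perp_triangle (parUnit C)
  rw [parUnitors_equal, parRightUnitor_naturality, reassoc_of% @distL_parRightUnitor,
    ← MonoidalCategory.whiskerLeft_comp_assoc] at h
  rw [← cancel_epi (ρ_ (parUnit C)).inv, Iso.inv_hom_id]
  exact h

lemma parCounit_parUnit_left (q : C) :
    parCounit (parUnit C) q = (parLeftUnitor q).hom ▷ _ ≫ (α_ _ _ _).inv ≫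
      perpCounit q ▷ _ ≫ perpCounit (parUnit C) := by
  rw [parCounit, ← parUnitors_equal]
  simp only [← MonoidalCategory.comp_whiskerRight_assoc]
  rw [parLeftUnitor_naturality, reassoc_of% @distR_parLeftUnitor]
  simp only [MonoidalCategory.comp_whiskerRight, Category.assoc,
    MonoidalCategory.associator_inv_naturality_left_assoc]

lemma parUnitMap_parUnit_left (q : C) :
    parUnitMap (parUnit C) q = perpUnit q ≫ ((ρ_ (perp q)).inv ≫ perp q ◁ unitToPerp C) ▷⅋ q ≫
      (perp q ⊗ perp (parUnit C)) ◁⅋ (parLeftUnitor q).inv := by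
  have h : (parAssoc (perp q ⊗ perp (parUnit C)) (parUnit C) q).hom =
      (parRightUnitor _).hom ▷⅋ q ≫ _ ◁⅋ (parLeftUnitor q).inv := by
    rw [← parTriangle, Category.assoc, ← parWhiskerLeft_comp]
    simp
  rw [parUnitMap, h]
  simp only [← reassoc_of% @comp_parWhiskerRight]
  rw [distL_parRightUnitor, ← MonoidalCategory.whiskerLeft_comp, unitToPerp]

/-- The triangle identity for `q* ⊗ d*` as a right dual of `d ⅋ q`. -/
lemma parUnitMap_parCounit_triangle (q : C) :
    (ρ_ (parUnit C ⅋ q)).inv ≫ (parUnit C ⅋ q) ◁ parUnitMap (parUnit C) q ≫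
      distL (parUnit C ⅋ q) (perp q ⊗ perp (parUnit C)) (parUnit C ⅋ q) ≫
      parCounit (parUnit C) q ▷⅋ (parUnit C ⅋ q) ≫ (parLeftUnitor (parUnit C ⅋ q)).hom =
      𝟙 (parUnit C ⅋ q) := by
  -- Absorbing `d*` through `e ⟶ d*` reduces the counit of `q* ⊗ d*` to that of `q*`, and the claim
  -- to the triangle identity for `q`.
  have h : q ◁ ((ρ_ (perp q)).inv ≫ perp q ◁ unitToPerp C) ≫ (α_ _ _ _).inv ≫
      perpCounit q ▷ _ ≫ perpCounit (parUnit C) = perpCounit q := by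
    simp only [MonoidalCategory.whiskerLeft_comp, Category.assoc,
      MonoidalCategory.associator_inv_naturality_right_assoc]
    rw [MonoidalCategory.whisker_exchange_assoc, whiskerLeft_unitToPerp_perpCounit]
    simp
  have h' : (parUnit C ⅋ q) ◁ ((ρ_ (perp q)).inv ≫ perp q ◁ unitToPerp C) ≫
      parCounit (parUnit C) q = (parLeftUnitor q).hom ▷ _ ≫ perpCounit q := by
    rw [parCounit_parUnit_left, MonoidalCategory.whisker_exchange_assoc, h]
  rw [parUnitMap_parUnit_left, MonoidalCategory.whiskerLeft_comp,
    MonoidalCategory.whiskerLeft_comp]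
  simp only [Category.assoc]
  rw [reassoc_of% @distL_naturality_right, reassoc_of% @par_whisker_exchange,
    parLeftUnitor_naturality,
    reassoc_of% @distL_naturality_middle, ← reassoc_of% @comp_parWhiskerRight, h',
    reassoc_of% @comp_parWhiskerRight,
    ← reassoc_of% @distL_naturality_left, MonoidalCategory.whisker_exchange_assoc,
    ← MonoidalCategory.rightUnitor_inv_naturality_assoc, reassoc_of% perp_triangle q,
    Iso.hom_inv_id]

end Duality

/-! ### Triviality of the braidings at the par unit, and balances -/

section Braided

variable {C : Type u} [Category.{v} C] [MonoidalCategory C] [ParCategory C]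
  [StarAutonomousCategory C] [BraidedCategory C]

/-- By naturality, the self-braiding of a retract of `e` is trivial because that of `e` is. -/
lemma braiding_perp_parUnit :
    (β_ (perp (parUnit C)) (perp (parUnit C))).hom = 𝟙 _ := by
  have h : (perpToUnit C ⊗ₘ perpToUnit C) ≫ (unitToPerp C ⊗ₘ unitToPerp C) = 𝟙 _ := by
    simp [perpToUnit_unitToPerp]
  have hb : (β_ (𝟙_ C) (𝟙_ C)).hom = 𝟙 _ := by
    rw [braiding_tensorUnit_left, MonoidalCategory.unitors_equal, Iso.hom_inv_id]
  rw [← Category.id_comp (β_ _ _).hom, ← h, Category.assoc, BraidedCategory.braiding_naturality,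
    hb, Category.id_comp]

@[simp]
lemma parBraiding_parUnit : parBraiding (parUnit C) (parUnit C) = 𝟙 _ := by
  rw [parBraiding, braiding_perp_parUnit, MonoidalCategory.whiskerLeft_id, Category.id_comp]
  exact parUnitMap_parCounit_triangle _

lemma fourPiTwist_eq_bend (p : C) :
    fourPiTwist p = bend ((β_ (perp p) p).inv ≫ (β_ p (perp p)).inv ≫ perpCounit p) := rfl

namespace IsBalance

variable {θ : 𝟭 C ≅ 𝟭 C}

/-- As the induced braiding on `d ⅋ d` is trivial, `θ` there is `θ_d ⅋ θ_d`; naturality at the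
unitor makes `θ_d` idempotent, and it is invertible. -/
lemma component_parUnit (hθ : IsBalance θ) : component θ (parUnit C) = 𝟙 _ := by
  have hn : component θ (parUnit C ⅋ parUnit C) ≫ (parLeftUnitor (parUnit C)).hom =
      (parLeftUnitor (parUnit C)).hom ≫ component θ (parUnit C) :=
    (θ.hom.naturality (parLeftUnitor (parUnit C)).hom).symm
  rw [hθ.par, parBraiding_parUnit, Category.id_comp, Category.comp_id, parHom_def,
    Category.assoc, parLeftUnitor_naturality, parUnitors_equal,
    reassoc_of% @parRightUnitor_naturality,
    cancel_epi] at hn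
  rw [← cancel_mono (component θ (parUnit C)), hn, Category.id_comp]

lemma inv_braiding_perpCounit (hθ : IsBalance θ) (p : C) :
    (β_ (perp p) p).inv ≫ (β_ p (perp p)).inv ≫ perpCounit p =
      component θ p ▷ perp p ≫ p ◁ component θ (perp p) ≫ perpCounit p := by
  have hn : component θ (p ⊗ perp p) ≫ perpCounit p =
      perpCounit p ≫ component θ (parUnit C) := (θ.hom.naturality (perpCounit p)).symm
  rw [hθ.component_parUnit, Category.comp_id, hθ.tensor] at hn
  simp only [Category.assoc] at hn
  -- Moving the twists past the second braiding collects the two braidings into a double braiding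
  -- that can be inverted.
  rw [BraidedCategory.braiding_naturality_assoc, MonoidalCategory.tensorHom_def,
    Category.assoc] at hn
  rw [Iso.inv_comp_eq, Iso.inv_comp_eq, hn]

lemma fourPiTwist_eq (hθ : IsBalance θ) (p : C) :
    fourPiTwist p = component θ p ≫ bend (p ◁ component θ (perp p) ≫ perpCounit p) := by
  rw [fourPiTwist_eq_bend, hθ.inv_braiding_perpCounit, bend_whiskerRight_comp]

end IsBalance

end Braided

end StarAut

theorem corollary4p7 {C : Type u} [Category.{v} C] [MonoidalCategory C] [StarAut.ParCategory C]
    [StarAut.StarAutonomousCategory C] [BraidedCategory C]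
    (θ : 𝟭 C ≅ 𝟭 C) (hθ : StarAut.IsBalance θ) :
    (∀ p : C, StarAut.component θ (StarAut.StarAutonomousCategory.perp p) =
        StarAut.perpMap (StarAut.component θ p)) ↔
      (∀ p : C, StarAut.fourPiTwist p = StarAut.component θ p ≫ StarAut.component θ p) := by
  refine forall_congr' fun p => ?_
  rw [StarAut.eq_perpMap_iff, hθ.fourPiTwist_eq, cancel_epi]
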